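/- Let $\mathbb K$ be a field, $n\ge 1$, $a_1,\dots,a_n\ge 1$ integers, and let $A=(x_{i_1,\dots,i_n})$ be the generic $a_1\times\cdots\times a_n$ table, with entries the variables of $R=\mathbb K[x_{i_1,\dots,i_n}\mid 1\le i_j\le a_j]$. For $J\subset\{1,\dots,n\}$ let $A_J$ be the $J$-margin of $A$, the table indexed by $(i_j)_{j\in J}$ obtained from $A$ by summing over all indices $i_j$ with $j\notin J$. Let $L_J\subset R$ be the ideal generated by the entries of $A_J$, and let $I(A_J)\subset R$ be the ideal generated by the generalized $2\times 2$ minors of $A_J$, that is, by the elements $b_u b_v-b_{u'}b_{v'}$, where $b_w$ denotes the entry of $A_J$ at index $w$, and $u',v'$ arise from indices $u,v$ by interchanging a single coordinate. For a collection $\Gamma$ of subsets of $\{1,\dots,n\}$ put $L_\Gamma=\sum_{J\in\Gamma}L_J$ and $I_\Gamma=\sum_{J\in\Gamma}I(A_J)$. Let $S_\Gamma$ be the polynomial ring over $\mathbb K$ with one variable for each entry of each $A_J$, $J\in\Gamma$; let $\tau_\Gamma\colon S_\Gamma\to R$ send each variable to the corresponding entry of $A_J$, and let $\sigma_\Gamma\colon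 S_\Gamma\to\mathbb K[y_{j,i}\mid 1\le j\le n,\ 1\le i\le a_j]$ be $\tau_\Gamma$ followed by the $\mathbb K$-algebra homomorphism $x_{i_1,\dots,i_n}\mapsto\prod_j y_{j,i_j}$. Let $P_\Gamma\subset R$ be the ideal generated by $\tau_\Gamma(\ker\sigma_\Gamma)$. If $k$ lies in every member of $\Gamma$, put $\Gamma\smallsetminus k=\{J\smallsetminus\{k\}\mid J\in\Gamma\}$. Let $\Delta$ be a simplicial complex on $\{1,\dots,n\}$, i.e. a collection of subsets closed under taking subsets. Then: (1) Let $\Delta_1\sqcup\cdots\sqcup\Delta_r$ be a partition of the set of facets of $\Delta$ into non-empty parts, and for each $i$ let $K_i\subset\bigcap_{J\in\Delta_i}J$ be a set such that $K_i\smallsetminus J\neq\emptyset$ for every facet $J$ of $\Delta$ not in $\Delta_i$. Then $$\mathfrak a=\sum_{i}P_{\Delta_i}+\sum_{i}\sum_{k\in K_i}L_{\Delta_i\smallsetminus k}$$ is a prime ideal of $R$. (2) Every minimal prime over $I_\Delta$ is equal to one of the ideals $\mathfrak a$ of (1), for some partition of the facets and some sets $K_i$ as in (1). -/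

import Mathlib

open scoped BigOperators

namespace MarginalIndependence

noncomputable section

/-- The `2 × 2` minor of a multiway table `B` about the coordinate `l`: the determinant of
`!![B i, B (j with l-th coordinate i l); B (i with l-th coordinate j l), B j]`. -/
def minor {ι : Type*} [DecidableEq ι] {α : ι → Type*} {R : Type*} [CommRing R]
    (B : (∀ j, α j) → R) (l : ι) (i j : ∀ j, α j) : R :=
  Matrix.det !![B i, B (Function.update j l (i l)); B (Function.update i l (j l)), B j]

/-- The ideal `I(B)` of complete independence of a multiway table `B`, generated by all its
`2 × 2` minors (interchanges of one coordinate). -/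
def segreIdeal {ι : Type*} [DecidableEq ι] {α : ι → Type*} {R : Type*} [CommRing R]
    (B : (∀ j, α j) → R) : Ideal R :=
  Ideal.span {f | ∃ (l : ι) (i j : ∀ j, α j), f = minor B l i j}

/-- The index set of an `a 0 × ⋯ × a (n-1)` table. -/
abbrev Cell {n : ℕ} (a : Fin n → ℕ) : Type := ∀ j : Fin n, Fin (a j)

/-- The index set of the `J`-margin of such a table. -/
abbrev MarginCell {n : ℕ} (a : Fin n → ℕ) (J : Finset (Fin n)) : Type :=
  ∀ j : {j : Fin n // j ∈ J}, Fin (a j.1)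

/-- The `J`-margin of a table: sum over all coordinates outside `J`. -/
def margin {n : ℕ} {a : Fin n → ℕ} {R : Type*} [CommRing R] (A : Cell a → R)
    (J : Finset (Fin n)) (b : MarginCell a J) : R :=
  ∑ i : Cell a with ∀ j : {j : Fin n // j ∈ J}, i j.1 = b j, A i

/-- The ring `𝕂[x_{i_1,…,i_n}]`. -/
abbrev TableRing (𝕂 : Type*) [Field 𝕂] {n : ℕ} (a : Fin n → ℕ) := MvPolynomial (Cell a) 𝕂

/-- The generic table. -/
def generic (𝕂 : Type*) [Field 𝕂] {n : ℕ} (a : Fin n → ℕ) : Cell a → TableRing 𝕂 a :=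
  fun i => MvPolynomial.X i

/-- `I_Δ`: the sum of the ideals `I(A_J)`, `J ∈ Δ`, for the generic table `A`. -/
def independenceIdeal (𝕂 : Type*) [Field 𝕂] {n : ℕ} (a : Fin n → ℕ)
    (Δ : Finset (Finset (Fin n))) : Ideal (TableRing 𝕂 a) :=
  ⨆ J ∈ Δ, segreIdeal (margin (generic 𝕂 a) J)

/-- `L_J`: the ideal generated by the entries of the `J`-margin of the generic table. -/
def marginIdeal (𝕂 : Type*) [Field 𝕂] {n : ℕ} (a : Fin n → ℕ) (J : Finset (Fin n)) :
    Ideal (TableRing 𝕂 a) :=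
  Ideal.span (Set.range (margin (generic 𝕂 a) J))

/-- `L_Γ`: the sum of the `L_J`, `J ∈ Γ`. -/
def marginsIdeal (𝕂 : Type*) [Field 𝕂] {n : ℕ} (a : Fin n → ℕ) (Γ : Finset (Finset (Fin n))) :
    Ideal (TableRing 𝕂 a) :=
  ⨆ J ∈ Γ, marginIdeal 𝕂 a J

/-- The ring `S_Γ`: one variable for each entry of each `J`-margin, `J ∈ Γ`. -/
abbrev MarginRing (𝕂 : Type*) [Field 𝕂] {n : ℕ} (a : Fin n → ℕ) (Γ : Finset (Finset (Fin n))) :=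
  MvPolynomial (Σ J : {J : Finset (Fin n) // J ∈ Γ}, MarginCell a J.1) 𝕂

/-- `τ_Γ`: a formal margin variable goes to the corresponding margin of the generic table. -/
def tau (𝕂 : Type*) [Field 𝕂] {n : ℕ} (a : Fin n → ℕ) (Γ : Finset (Finset (Fin n))) :
    MarginRing 𝕂 a Γ →ₐ[𝕂] TableRing 𝕂 a :=
  MvPolynomial.aeval fun s => margin (generic 𝕂 a) s.1.1 s.2

/-- The parametrization `x_{i_1,…,i_n} ↦ ∏ j, y_{j,i_j}` of the Segre variety. -/
def segreMap (𝕂 : Type*) [Field 𝕂] {n : ℕ} (a : Fin n → ℕ) :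
    TableRing 𝕂 a →ₐ[𝕂] MvPolynomial (Σ j : Fin n, Fin (a j)) 𝕂 :=
  MvPolynomial.aeval fun i => ∏ j : Fin n, MvPolynomial.X (Sigma.mk j (i j))

/-- `σ_Γ`, the composite of `τ_Γ` with the Segre parametrization. -/
def sigma (𝕂 : Type*) [Field 𝕂] {n : ℕ} (a : Fin n → ℕ) (Γ : Finset (Finset (Fin n))) :
    MarginRing 𝕂 a Γ →ₐ[𝕂] MvPolynomial (Σ j : Fin n, Fin (a j)) 𝕂 :=
  (segreMap 𝕂 a).comp (tau 𝕂 a Γ)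

/-- `P_Γ` as an ideal of `𝕂[x_{i_1,…,i_n}]`: the ideal generated there by the image of `ker σ_Γ`,
i.e. by the polynomials in the `Γ`-margins that vanish on the Segre variety.
(It depends only on the simplicial complex generated by `Γ`.) -/
def mainIdeal (𝕂 : Type*) [Field 𝕂] {n : ℕ} (a : Fin n → ℕ) (Γ : Finset (Finset (Fin n))) :
    Ideal (TableRing 𝕂 a) :=
  (RingHom.ker (sigma 𝕂 a Γ)).map (tau 𝕂 a Γ)

open Classical in
/-- The facets (maximal faces) of `Δ`. -/
def facets {n : ℕ} (Δ : Finset (Finset (Fin n))) : Finset (Finset (Fin n)) :=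
  Δ.filter fun J => Maximal (fun F => F ∈ Δ) J

/-- `Γ ∖ k`: remove the vertex `k` from every member of `Γ`. -/
def deleteVertex {n : ℕ} (Γ : Finset (Finset (Fin n))) (k : Fin n) : Finset (Finset (Fin n)) :=
  Γ.image fun J => J.erase k

/-- A choice `κ Γ` of a set for each part `Γ` of a partition of the facets of `Δ`, such that
`κ Γ` is contained in all facets in `Γ` and in no facet outside `Γ`. -/
def Admissible {n : ℕ} {Δ : Finset (Finset (Fin n))} (π : Finpartition (facets Δ))
    (κ : Finset (Finset (Fin n)) → Finset (Fin n)) : Prop :=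
  ∀ Γ ∈ π.parts, (∀ J ∈ Γ, κ Γ ⊆ J) ∧ ∀ J ∈ facets Δ, J ∉ Γ → (κ Γ \ J).Nonempty

/-- `∑_Γ P_Γ + ∑_Γ ∑_{k ∈ κ Γ} L_{Γ ∖ k}`, `Γ` running over the parts of the partition. -/
def componentIdeal (𝕂 : Type*) [Field 𝕂] {n : ℕ} (a : Fin n → ℕ) {Δ : Finset (Finset (Fin n))}
    (π : Finpartition (facets Δ)) (κ : Finset (Finset (Fin n)) → Finset (Fin n)) :
    Ideal (TableRing 𝕂 a) :=
  (⨆ Γ ∈ π.parts, mainIdeal 𝕂 a Γ) ⊔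
    ⨆ Γ ∈ π.parts, ⨆ k ∈ κ Γ, marginsIdeal 𝕂 a (deleteVertex Γ k)

end

end MarginalIndependence

/-! Let the index `0` of a coordinate stand for summation over that coordinate. The face sum at a
cell `w` is then an entry of the margin on `supp w`, and the face sums are new linear coordinates on
`R` (`faceMap_bijective`). The entries of the `J`-margin and the face sums supported in `J` generate
the same additive group, so `P_Γ` and `L_Γ` can be treated through face sums.

For (1), map a face sum to a Segre monomial in parameters private to the part `Γ` if its support
lies in a member of `Γ` and contains `κ Γ`, to `0` if it lies below a facet but fails this, and to a
free variable if it lies below no facet. Admissibility makes the parts independent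
(`Good.eq_of_inFace`). The map sends monomials to monomials or `0`, so its kernel is controlled by
monomials and binomials, which lie in the component ideal (`componentIdeal_eq_ker`). The target is a
domain, so the ideal is prime; it also contains `I_Δ`.

For (2), evaluate the face sums in the fraction field of `R/𝔭`. On each facet they form a rank-one
table whose nonzero cells have a least support. Grouping facets by this support, and taking it as
`κ`, gives an admissible datum whose component ideal lies in `𝔭` (`exists_componentIdeal_le`).
Minimality of `𝔭` gives equality. -/

namespace MarginalIndependence

/-! ### Margins and face sums -/

section Table

variable {n : ℕ} {a : Fin n → ℕ} {R : Type*} [CommRing R]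

/-- The sum of the entries of a table over a box. -/
def boxSum (A : Cell a → R) (t : ∀ j, Finset (Fin (a j))) : R :=
  ∑ i ∈ Fintype.piFinset t, A i

theorem boxSum_split (A : Cell a → R) (t : ∀ j, Finset (Fin (a j))) (j : Fin n) :
    boxSum A t = ∑ c ∈ t j, boxSum A (Function.update t j {c}) := by
  unfold boxSum
  rw [← Finset.sum_fiberwise_of_maps_to (s := Fintype.piFinset t) (t := t j) (g := fun i => i j)
    (fun i hi => Fintype.mem_piFinset.1 hi j)]
  refine Finset.sum_congr rfl fun c hc => Finset.sum_congr ?_ fun _ _ => rfl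
  ext i
  simp only [Finset.mem_filter, Fintype.mem_piFinset]
  constructor
  · rintro ⟨h, rfl⟩ k
    rcases eq_or_ne k j with rfl | hk
    · simp
    · simpa [Function.update_of_ne hk] using h k
  · intro h
    have hj : i j = c := by simpa using h j
    refine ⟨fun k => ?_, hj⟩
    rcases eq_or_ne k j with rfl | hk
    · rwa [hj]
    · simpa [Function.update_of_ne hk] using h k

theorem margin_restrict_eq_boxSum (A : Cell a → R) (J : Finset (Fin n)) (i : Cell a) :
    margin A J (fun j => i j.1) = boxSum A (fun j => if j ∈ J then {i j} else Finset.univ) := by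
  unfold margin boxSum
  refine Finset.sum_congr ?_ fun _ _ => rfl
  ext k
  simp only [Finset.mem_filter, Finset.mem_univ, true_and, Subtype.forall, Fintype.mem_piFinset]
  refine forall_congr' fun j => ?_
  by_cases hj : j ∈ J <;> simp [hj]

theorem map_boxSum {S : Type*} [CommRing S] (f : R →+* S) (A : Cell a → R)
    (t : ∀ j, Finset (Fin (a j))) : f (boxSum A t) = boxSum (fun i => f (A i)) t := by
  simp [boxSum]

theorem map_margin {S : Type*} [CommRing S] (f : R →+* S) (A : Cell a → R)
    (J : Finset (Fin n)) (b : MarginCell a J) :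
    f (margin A J b) = margin (fun i => f (A i)) J b := by
  simp [margin]

theorem map_minor {ι : Type*} [DecidableEq ι] {α : ι → Type*} {S : Type*} [CommRing S]
    (f : R →+* S) (B : (∀ j, α j) → R) (l : ι) (i j : ∀ j, α j) :
    f (minor B l i j) = minor (fun b => f (B b)) l i j := by
  simp [minor, Matrix.det_fin_two_of]

variable [∀ j, NeZero (a j)]

/-- The set of nonzero coordinates of a cell. -/
def supp (w : Cell a) : Finset (Fin n) := Finset.univ.filter fun j => w j ≠ 0

@[simp] theorem mem_supp {w : Cell a} {j : Fin n} : j ∈ supp w ↔ w j ≠ 0 := by simp [supp]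

/-- The index `0` stands for the full range of a coordinate, any other index for itself. -/
def slot {j : Fin n} (c : Fin (a j)) : Finset (Fin (a j)) := if c = 0 then Finset.univ else {c}

/-- The entry of the `supp w`-margin at `w`. -/
def faceSum (A : Cell a → R) (w : Cell a) : R := boxSum A fun j => slot (w j)

theorem exists_restrict_eq {J : Finset (Fin n)} (b : MarginCell a J) :
    ∃ i : Cell a, supp i ⊆ J ∧ b = fun j : {j // j ∈ J} => i j.1 := by
  refine ⟨fun j => if h : j ∈ J then b ⟨j, h⟩ else 0, fun j hj => ?_, ?_⟩
  · by_contra h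
    simp [h] at hj
  · funext j
    simp

theorem faceSum_eq_sum_margin (A : Cell a → R) {J : Finset (Fin n)} {w : Cell a}
    (hw : supp w ⊆ J) :
    faceSum A w = ∑ b : MarginCell a J with ∀ j, b j ∈ slot (w j.1), margin A J b := by
  unfold faceSum boxSum margin
  rw [← Finset.sum_fiberwise_of_maps_to (s := Fintype.piFinset fun j => slot (w j))
    (g := fun i => (fun j => i j.1 : MarginCell a J))
    (t := Finset.univ.filter fun b => ∀ j, b j ∈ slot (w j.1))
    (fun i hi => by
      simp only [Finset.mem_filter, Finset.mem_univ, true_and]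
      exact fun j => Fintype.mem_piFinset.1 hi j.1)]
  refine Finset.sum_congr rfl fun b hb => Finset.sum_congr ?_ fun _ _ => rfl
  ext i
  simp only [Finset.mem_filter, Fintype.mem_piFinset, Finset.mem_univ, true_and] at hb ⊢
  constructor
  · rintro ⟨_, rfl⟩ j
    rfl
  · intro h
    refine ⟨fun j => ?_, funext h⟩
    by_cases hj : j ∈ J
    · have := hb ⟨j, hj⟩
      rwa [← h ⟨j, hj⟩] at this
    · have : w j = 0 := by
        by_contra h0
        exact hj (hw (by simpa using h0))
      simp [slot, this]

theorem faceSum_mem_of_margin_mem {A : Cell a → R} {J : Finset (Fin n)} {M : AddSubgroup R}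
    (h : ∀ b, margin A J b ∈ M) {w : Cell a} (hw : supp w ⊆ J) : faceSum A w ∈ M := by
  rw [faceSum_eq_sum_margin A hw]
  exact sum_mem fun b _ => h b

/-- Undoes the summation convention one coordinate at a time: on `Q` the index `0` already means the
actual entry, elsewhere it still means the full sum. -/
theorem boxSum_mem_of_faceSum_mem {A : Cell a → R} {J : Finset (Fin n)} {M : AddSubgroup R}
    (h : ∀ w, supp w ⊆ J → faceSum A w ∈ M) (Q : Finset (Fin n)) (hQ : Q ⊆ J) :
    ∀ w, supp w ⊆ J → boxSum A (fun j => if j ∈ Q then {w j} else slot (w j)) ∈ M := by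
  induction Q using Finset.induction_on with
  | empty => intro w hw; simpa [faceSum] using h w hw
  | insert k Q hk ih =>
    intro w hw
    have ih := ih ((Finset.subset_insert _ _).trans hQ)
    have hupd : ∀ c : Fin (a k), boxSum A (Function.update
        (fun j => if j ∈ Q then {w j} else slot (w j)) k {c}) =
        boxSum A (fun j => if j ∈ insert k Q then {Function.update w k c j}
          else slot (Function.update w k c j)) := by
      intro c
      congr 1
      funext j
      rcases eq_or_ne j k with rfl | hj
      · simp
      · simp [Finset.mem_insert, hj]
    have hsupp : ∀ c : Fin (a k), supp (Function.update w k c) ⊆ J := by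
      intro c j hj
      rcases eq_or_ne j k with rfl | hjk
      · exact hQ (Finset.mem_insert_self _ _)
      · exact hw (by simpa [Function.update_of_ne hjk] using hj)
    have hne : ∀ w : Cell a, supp w ⊆ J → w k ≠ 0 →
        boxSum A (fun j => if j ∈ insert k Q then {w j} else slot (w j)) ∈ M := by
      intro w hw h0
      convert ih w hw using 2
      funext j
      rcases eq_or_ne j k with rfl | hj
      · simp [hk, slot, h0]
      · simp [Finset.mem_insert, hj]
    by_cases h0 : w k = 0
    -- The full sum over coordinate `k` and its terms of nonzero index lie in `M`, hence so does the
    -- term of index `0`.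
    · have key := ih w hw
      rw [boxSum_split A _ k] at key
      simp only [hk, if_false, h0, slot, if_true] at key
      rw [← Finset.add_sum_erase _ _ (Finset.mem_univ (0 : Fin (a k)))] at key
      have h2 := (AddSubgroup.add_mem_cancel_right M (M.sum_mem fun c hc => ?_)).1 key
      · have := hupd 0
        rw [← h0, Function.update_eq_self] at this
        rw [← this, h0]
        exact h2
      · have := hupd c
        simp only [slot] at this
        rw [this]
        refine hne _ (hsupp c) ?_
        simpa using Finset.ne_of_mem_erase hc
    · exact hne w hw h0

theorem margin_mem_of_faceSum_mem {A : Cell a → R} {J : Finset (Fin n)} {M : AddSubgroup R}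
    (h : ∀ w, supp w ⊆ J → faceSum A w ∈ M) (b : MarginCell a J) : margin A J b ∈ M := by
  obtain ⟨i, hi, rfl⟩ := exists_restrict_eq b
  rw [margin_restrict_eq_boxSum]
  convert boxSum_mem_of_faceSum_mem h J subset_rfl i hi using 2
  funext j
  by_cases hj : j ∈ J
  · simp [hj]
  · have : i j = 0 := by
      by_contra h0
      exact hj (hi (by simpa using h0))
    simp [hj, slot, this]

theorem supp_update_subset {J : Finset (Fin n)} {w v : Cell a} (hw : supp w ⊆ J)
    (hv : supp v ⊆ J) (l : Fin n) : supp (Function.update w l (v l)) ⊆ J := by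
  intro j hj
  rcases eq_or_ne j l with rfl | hjl
  · exact hv (by simpa using hj)
  · exact hw (by simpa [Function.update_of_ne hjl] using hj)

/-- If all minors of a margin vanish, then so do those of the table of its face sums. -/
theorem faceSum_mul_faceSum {A : Cell a → R} {J : Finset (Fin n)}
    (h : ∀ l i j, minor (margin A J) l i j = 0) {w v : Cell a} (hw : supp w ⊆ J)
    (hv : supp v ⊆ J) (l : Fin n) :
    faceSum A w * faceSum A v =
      faceSum A (Function.update w l (v l)) * faceSum A (Function.update v l (w l)) := by
  by_cases hl : l ∈ J
  · rw [faceSum_eq_sum_margin A hw, faceSum_eq_sum_margin A hv,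
      faceSum_eq_sum_margin A (supp_update_subset hw hv l),
      faceSum_eq_sum_margin A (supp_update_subset hv hw l), Finset.sum_mul_sum,
      Finset.sum_mul_sum, ← Finset.sum_product', ← Finset.sum_product']
    -- Exchanging the `l`-th coordinates is an involution that matches the two expanded products
    -- term by term, each match being a minor.
    let s : MarginCell a J × MarginCell a J → MarginCell a J × MarginCell a J := fun p =>
      (Function.update p.1 ⟨l, hl⟩ (p.2 ⟨l, hl⟩), Function.update p.2 ⟨l, hl⟩ (p.1 ⟨l, hl⟩))
    have hs : ∀ p, s (s p) = p := by
      rintro ⟨p, q⟩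
      simp [s]
    have hmem : ∀ w v : Cell a, ∀ p : MarginCell a J × MarginCell a J,
        (∀ j, p.1 j ∈ slot (w j.1)) ∧ (∀ j, p.2 j ∈ slot (v j.1)) →
        (∀ j, (s p).1 j ∈ slot (Function.update w l (v l) j.1)) ∧
          (∀ j, (s p).2 j ∈ slot (Function.update v l (w l) j.1)) := by
      rintro w v ⟨p, q⟩ ⟨hp, hq⟩
      constructor <;> rintro ⟨j, hj⟩ <;> rcases eq_or_ne j l with rfl | hjl
      · simpa [s] using hq ⟨j, hj⟩
      · simpa [s, Function.update_of_ne, hjl] using hp ⟨j, hj⟩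
      · simpa [s] using hp ⟨j, hj⟩
      · simpa [s, Function.update_of_ne, hjl] using hq ⟨j, hj⟩
    refine Finset.sum_nbij' s s ?_ ?_ (fun p _ => hs p) (fun p _ => hs p) ?_
    · intro p hp
      simp only [Finset.mem_product, Finset.mem_filter, Finset.mem_univ, true_and] at hp ⊢
      exact hmem w v p hp
    · intro p hp
      simp only [Finset.mem_product, Finset.mem_filter, Finset.mem_univ, true_and] at hp ⊢
      have := hmem _ _ p hp
      simpa using this
    · rintro ⟨p, q⟩ -
      have := h ⟨l, hl⟩ p q
      rw [minor, Matrix.det_fin_two_of, sub_eq_zero] at this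
      rw [this, mul_comm]
  · have h0 : ∀ u : Cell a, supp u ⊆ J → u l = 0 := by
      intro u hu
      by_contra h0
      exact hl (hu (by simpa using h0))
    rw [h0 v hv, ← h0 w hw, Function.update_eq_self, h0 w hw, ← h0 v hv, Function.update_eq_self]

theorem map_faceSum {S : Type*} [CommRing S] (f : R →+* S) (A : Cell a → R) (w : Cell a) :
    f (faceSum A w) = faceSum (fun i => f (A i)) w := map_boxSum f A _

end Table

/-! ### Two algebraic tools -/

/-- A surjective endomorphism of a Noetherian ring is injective. -/
theorem ringHom_injective_of_surjective {R : Type*} [CommRing R] [IsNoetherianRing R]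
    (f : R →+* R) (hf : Function.Surjective f) : Function.Injective f := by
  have hpow : ∀ k m : ℕ, ∀ x : R, (f ^ k) ((f ^ m) x) = (f ^ (k + m)) x := by
    intro k m x
    rw [pow_add]
    rfl
  have hmono : Monotone fun k : ℕ => RingHom.ker (f ^ k) := by
    intro k m hkm x hx
    rw [RingHom.mem_ker] at hx ⊢
    rw [← Nat.sub_add_cancel hkm, ← hpow, hx, map_zero]
  obtain ⟨k, hk⟩ := monotone_stabilizes_iff_noetherian.2 ‹IsNoetherianRing R› ⟨_, hmono⟩
  have hsurj : Function.Surjective (f ^ k) := by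
    rw [RingHom.coe_pow]
    exact hf.iterate k
  refine (injective_iff_map_eq_zero f).2 fun x hx => ?_
  obtain ⟨y, rfl⟩ := hsurj x
  have h1 : y ∈ RingHom.ker (f ^ (k + 1)) := by
    rw [RingHom.mem_ker, add_comm, ← hpow, pow_one, hx]
  have h2 := hk (k + 1) (Nat.le_succ k)
  simp only [OrderHom.coe_mk] at h2
  rwa [← h2, RingHom.mem_ker] at h1

open Classical in
/-- Let `f` send monomials to monomials or to `0`. If the ideal `I` contains every monomial
in the kernel of `f` and every difference of two monomials with the same nonzero image,
then it contains the kernel. -/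
theorem ker_le_of_monomial {𝕂 σ τ : Type*} [Field 𝕂]
    (f : MvPolynomial σ 𝕂 →ₐ[𝕂] MvPolynomial τ 𝕂) (I : Ideal (MvPolynomial σ 𝕂))
    (hf : ∀ α, f (MvPolynomial.monomial α 1) = 0 ∨
      ∃ m, f (MvPolynomial.monomial α 1) = MvPolynomial.monomial m 1)
    (h0 : ∀ α, f (MvPolynomial.monomial α 1) = 0 → MvPolynomial.monomial α 1 ∈ I)
    (h1 : ∀ α β, f (MvPolynomial.monomial α 1) ≠ 0 →
      f (MvPolynomial.monomial α 1) = f (MvPolynomial.monomial β 1) →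
      MvPolynomial.monomial α 1 - MvPolynomial.monomial β 1 ∈ I) :
    RingHom.ker f ≤ I := by
  -- A linear map `L` with `L ∘ f` equal to the quotient map: lift a monomial to any preimage
  -- monomial, the choice being irrelevant modulo `I` by `h1`.
  let s : (τ →₀ ℕ) → MvPolynomial σ 𝕂 ⧸ I := fun m =>
    if h : ∃ α, f (MvPolynomial.monomial α 1) = MvPolynomial.monomial m 1 then
      Ideal.Quotient.mkₐ 𝕂 I (MvPolynomial.monomial h.choose 1) else 0
  let L : MvPolynomial τ 𝕂 →ₗ[𝕂] MvPolynomial σ 𝕂 ⧸ I :=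
    (MvPolynomial.basisMonomials τ 𝕂).constr 𝕂 s
  have hL : ∀ m, L (MvPolynomial.monomial m 1) = s m := fun m =>
    (MvPolynomial.basisMonomials τ 𝕂).constr_basis 𝕂 s m
  have key : L ∘ₗ f.toLinearMap = (Ideal.Quotient.mkₐ 𝕂 I).toLinearMap := by
    refine (MvPolynomial.basisMonomials σ 𝕂).ext fun α => ?_
    simp only [MvPolynomial.coe_basisMonomials, LinearMap.comp_apply, AlgHom.toLinearMap_apply]
    rcases hf α with h | ⟨m, hm⟩
    · rw [h, map_zero, eq_comm]
      exact Ideal.Quotient.eq_zero_iff_mem.2 (h0 α h)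
    · have hex : ∃ α, f (MvPolynomial.monomial α 1) = MvPolynomial.monomial m 1 := ⟨α, hm⟩
      rw [hm, hL]
      simp only [s, dif_pos hex]
      refine Ideal.Quotient.eq.2 (h1 _ _ ?_ (hex.choose_spec.trans hm.symm))
      rw [hex.choose_spec, Ne, MvPolynomial.monomial_eq_zero]
      exact one_ne_zero
  intro x hx
  have := LinearMap.congr_fun key x
  simp only [LinearMap.comp_apply, AlgHom.toLinearMap_apply] at this
  rw [RingHom.mem_ker] at hx
  rw [hx, map_zero] at this
  exact Ideal.Quotient.eq_zero_iff_mem.1 this.symm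

/-! ### The generic table in face sum coordinates -/

section Generic

variable {𝕂 : Type*} [Field 𝕂] {n : ℕ} {a : Fin n → ℕ}

theorem segreMap_boxSum (t : ∀ j, Finset (Fin (a j))) :
    segreMap 𝕂 a (boxSum (generic 𝕂 a) t) = ∏ j, ∑ c ∈ t j, MvPolynomial.X (Sigma.mk j c) := by
  rw [Finset.prod_univ_sum, boxSum, map_sum]
  refine Finset.sum_congr rfl fun i _ => ?_
  simp [segreMap, generic]

theorem segreMap_margin (J : Finset (Fin n)) (i : Cell a) :
    segreMap 𝕂 a (margin (generic 𝕂 a) J (fun j => i j.1)) =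
      ∏ j, ∑ c ∈ if j ∈ J then {i j} else Finset.univ, MvPolynomial.X (Sigma.mk j c) := by
  rw [margin_restrict_eq_boxSum, segreMap_boxSum]

/-- If two products of powers of face sums (or ones) have equal Segre images, they are congruent
modulo `P_Γ`. -/
theorem prod_sub_prod_mem_mainIdeal {Γ : Finset (Finset (Fin n))} {g : Cell a → TableRing 𝕂 a}
    (hg : ∀ w, ∃ ζ, tau 𝕂 a Γ ζ = g w) {α β : Cell a → ℕ}
    (h : ∏ w, segreMap 𝕂 a (g w) ^ α w = ∏ w, segreMap 𝕂 a (g w) ^ β w) :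
    ∏ w, g w ^ α w - ∏ w, g w ^ β w ∈ mainIdeal 𝕂 a Γ := by
  choose ζ hζ using hg
  have : ∏ w, g w ^ α w - ∏ w, g w ^ β w =
      tau 𝕂 a Γ (∏ w, ζ w ^ α w - ∏ w, ζ w ^ β w) := by
    simp [hζ]
  rw [this]
  refine Ideal.mem_map_of_mem _ ?_
  rw [RingHom.mem_ker]
  simp [sigma, hζ, h]

variable [∀ j, NeZero (a j)]

variable (𝕂 a) in
/-- The linear change of coordinates from cells to face sums. -/
noncomputable def faceMap : TableRing 𝕂 a →ₐ[𝕂] TableRing 𝕂 a :=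
  MvPolynomial.aeval fun w => faceSum (generic 𝕂 a) w

@[simp] theorem faceMap_X (w : Cell a) :
    faceMap 𝕂 a (MvPolynomial.X w) = faceSum (generic 𝕂 a) w := by
  simp [faceMap]

/-- Each variable is an entry of the full margin, hence an integer combination of face sums;
surjectivity then suffices. -/
theorem faceMap_bijective : Function.Bijective (faceMap 𝕂 a) := by
  have hs : Function.Surjective (faceMap 𝕂 a) := by
    rw [← AlgHom.range_eq_top, eq_top_iff, ← MvPolynomial.adjoin_range_X, Algebra.adjoin_le_iff]
    rintro _ ⟨i, rfl⟩
    have := margin_mem_of_faceSum_mem (A := generic 𝕂 a) (J := Finset.univ)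
      (M := (faceMap 𝕂 a).range.toSubring.toAddSubgroup)
      (fun w _ => ⟨MvPolynomial.X w, faceMap_X w⟩) (fun j => i j.1)
    rw [margin_restrict_eq_boxSum] at this
    simpa [boxSum, generic, Fintype.piFinset_singleton] using this
  exact ⟨ringHom_injective_of_surjective (faceMap 𝕂 a).toRingHom hs, hs⟩

variable (𝕂 a) in
/-- The change of coordinates as an automorphism. -/
noncomputable def faceEquiv : TableRing 𝕂 a ≃ₐ[𝕂] TableRing 𝕂 a :=
  AlgEquiv.ofBijective (faceMap 𝕂 a) faceMap_bijective

@[simp] theorem faceEquiv_symm_faceSum (w : Cell a) :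
    (faceEquiv 𝕂 a).symm (faceSum (generic 𝕂 a) w) = MvPolynomial.X w := by
  rw [AlgEquiv.symm_apply_eq]
  simp [faceEquiv]

theorem segreMap_faceSum (w : Cell a) :
    segreMap 𝕂 a (faceSum (generic 𝕂 a) w) =
      ∏ j, ∑ c ∈ slot (w j), MvPolynomial.X (Sigma.mk j c) :=
  segreMap_boxSum _

/-- Product tables in face sum coordinates are specializations of the Segre parametrization. The
parameter of index `0` is chosen so that the sum of all parameters of coordinate `j` becomes `η j
0`. -/
theorem exists_algHom_segreMap_faceSum {C : Type*} [CommRing C] [Algebra 𝕂 C]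
    (η : ∀ j, Fin (a j) → C) :
    ∃ h : MvPolynomial (Σ j : Fin n, Fin (a j)) 𝕂 →ₐ[𝕂] C,
      ∀ w, h (segreMap 𝕂 a (faceSum (generic 𝕂 a) w)) = ∏ j, η j (w j) := by
  refine ⟨MvPolynomial.aeval fun s =>
    if s.2 = 0 then η s.1 0 - ∑ c ∈ Finset.univ.erase 0, η s.1 c else η s.1 s.2, fun w => ?_⟩
  rw [segreMap_faceSum, map_prod]
  refine Finset.prod_congr rfl fun j _ => ?_
  rw [map_sum]
  by_cases h : w j = 0
  · simp only [slot, h, if_true]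
    rw [← Finset.add_sum_erase _ _ (Finset.mem_univ (0 : Fin (a j)))]
    have : ∀ c ∈ Finset.univ.erase (0 : Fin (a j)),
        MvPolynomial.aeval (R := 𝕂) (fun s : (Σ j : Fin n, Fin (a j)) =>
          if s.2 = 0 then η s.1 0 - ∑ c ∈ Finset.univ.erase 0, η s.1 c else η s.1 s.2)
          (MvPolynomial.X (Sigma.mk j c)) = η j c := by
      intro c hc
      simp [Finset.ne_of_mem_erase hc]
    rw [Finset.sum_congr rfl this]
    simp
  · simp [slot, h]

/-- The support of the cell is contained in a member of the collection. -/
def InFace (Γ : Finset (Finset (Fin n))) (w : Cell a) : Prop := ∃ J ∈ Γ, supp w ⊆ J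

theorem algHom_margin_eq {C : Type*} [CommRing C] [Algebra 𝕂 C] {f g : TableRing 𝕂 a →ₐ[𝕂] C}
    {J : Finset (Fin n)}
    (h : ∀ w, supp w ⊆ J → f (faceSum (generic 𝕂 a) w) = g (faceSum (generic 𝕂 a) w))
    (b : MarginCell a J) : f (margin (generic 𝕂 a) J b) = g (margin (generic 𝕂 a) J b) :=
  margin_mem_of_faceSum_mem
    (M := AddMonoidHom.eqLocus (f : TableRing 𝕂 a →+ C) (g : TableRing 𝕂 a →+ C)) h b

theorem algHom_margin_eq_zero {C : Type*} [CommRing C] [Algebra 𝕂 C] {f : TableRing 𝕂 a →ₐ[𝕂] C}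
    {J : Finset (Fin n)} (h : ∀ w, supp w ⊆ J → f (faceSum (generic 𝕂 a) w) = 0)
    (b : MarginCell a J) : f (margin (generic 𝕂 a) J b) = 0 :=
  margin_mem_of_faceSum_mem (M := (RingHom.ker f).toAddSubgroup) h b

/-- A product formula below `Γ` makes `g ∘ τ_Γ` factor through `σ_Γ`. -/
theorem mainIdeal_le_ker {C : Type*} [CommRing C] [Algebra 𝕂 C] (g : TableRing 𝕂 a →ₐ[𝕂] C)
    {Γ : Finset (Finset (Fin n))} (η : ∀ j, Fin (a j) → C)
    (h : ∀ w, InFace Γ w → g (faceSum (generic 𝕂 a) w) = ∏ j, η j (w j)) :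
    mainIdeal 𝕂 a Γ ≤ RingHom.ker g := by
  obtain ⟨φ, hφ⟩ := exists_algHom_segreMap_faceSum (𝕂 := 𝕂) η
  have key : g.comp (tau 𝕂 a Γ) = φ.comp (sigma 𝕂 a Γ) := by
    refine MvPolynomial.algHom_ext fun s => ?_
    have := algHom_margin_eq (f := g) (g := φ.comp (segreMap 𝕂 a)) (J := s.1.1)
      (fun w hw => (h w ⟨_, s.1.2, hw⟩).trans (hφ w).symm) s.2
    simpa [sigma, tau] using this
  refine Ideal.map_le_iff_le_comap.2 fun x hx => ?_
  rw [RingHom.mem_ker] at hx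
  have := DFunLike.congr_fun key x
  simp only [AlgHom.comp_apply] at this
  rw [hx, map_zero] at this
  exact this

/-- Each margin entry maps to a product with one factor per coordinate, and an exchange only
permutes factors between two such products. -/
theorem minor_segreMap_margin (J : Finset (Fin n)) (l : {j // j ∈ J}) (b b' : MarginCell a J) :
    minor (fun b => segreMap 𝕂 a (margin (generic 𝕂 a) J b)) l b b' = 0 := by
  obtain ⟨i, -, rfl⟩ := exists_restrict_eq b
  obtain ⟨i', -, rfl⟩ := exists_restrict_eq b'
  have hupd : ∀ i i' : Cell a, Function.update (fun j : {j // j ∈ J} => i j.1) l (i' l.1) =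
      fun j : {j // j ∈ J} => Function.update i l.1 (i' l.1) j.1 := by
    intro i i'
    funext j
    rcases eq_or_ne j l with rfl | hj
    · simp
    · rw [Function.update_of_ne hj, Function.update_of_ne (fun h => hj (Subtype.ext h))]
  rw [minor, Matrix.det_fin_two_of, hupd, hupd, segreMap_margin, segreMap_margin,
    segreMap_margin, segreMap_margin, sub_eq_zero, ← Finset.prod_mul_distrib,
    ← Finset.prod_mul_distrib]
  refine Finset.prod_congr rfl fun j _ => ?_
  rcases eq_or_ne j l.1 with rfl | hj
  · simp
  · simp [Function.update_of_ne hj, mul_comm]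

theorem segreIdeal_margin_le_ker {C : Type*} [CommRing C] [Algebra 𝕂 C]
    (g : TableRing 𝕂 a →ₐ[𝕂] C) {J : Finset (Fin n)} (η : ∀ j, Fin (a j) → C)
    (h : ∀ w, supp w ⊆ J → g (faceSum (generic 𝕂 a) w) = ∏ j, η j (w j)) :
    segreIdeal (margin (generic 𝕂 a) J) ≤ RingHom.ker g := by
  obtain ⟨φ, hφ⟩ := exists_algHom_segreMap_faceSum (𝕂 := 𝕂) η
  refine Ideal.span_le.2 ?_
  rintro _ ⟨l, b, b', rfl⟩
  rw [SetLike.mem_coe, RingHom.mem_ker]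
  have h1 := map_minor (g : TableRing 𝕂 a →+* C) (margin (generic 𝕂 a) J) l b b'
  have h2 := map_minor (φ : MvPolynomial (Σ j : Fin n, Fin (a j)) 𝕂 →+* C)
    (fun b => segreMap 𝕂 a (margin (generic 𝕂 a) J b)) l b b'
  rw [minor_segreMap_margin, map_zero] at h2
  refine h1.trans ?_
  rw [h2]
  congr 1
  funext c
  exact algHom_margin_eq (f := g) (g := φ.comp (segreMap 𝕂 a))
    (fun w hw => (h w hw).trans (hφ w).symm) c

theorem exists_tau_eq_faceSum {Γ : Finset (Finset (Fin n))} {w : Cell a} (hw : InFace Γ w) :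
    ∃ ζ, tau 𝕂 a Γ ζ = faceSum (generic 𝕂 a) w := by
  obtain ⟨J, hJ, hw⟩ := hw
  exact faceSum_mem_of_margin_mem (M := (tau 𝕂 a Γ).range.toSubring.toAddSubgroup)
    (fun b => ⟨MvPolynomial.X ⟨⟨J, hJ⟩, b⟩, by simp [tau]⟩) hw

theorem faceSum_mem_marginsIdeal {Γ : Finset (Finset (Fin n))} {w : Cell a} (hw : InFace Γ w) :
    faceSum (generic 𝕂 a) w ∈ marginsIdeal 𝕂 a Γ := by
  obtain ⟨J, hJ, hw⟩ := hw
  exact faceSum_mem_of_margin_mem (M := (marginsIdeal 𝕂 a Γ).toAddSubgroup)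
    (fun b => le_iSup₂_of_le (f := fun J _ => marginIdeal 𝕂 a J) J hJ le_rfl
      (Ideal.subset_span ⟨b, rfl⟩)) hw

theorem marginsIdeal_le_ker {C : Type*} [CommRing C] [Algebra 𝕂 C] (g : TableRing 𝕂 a →ₐ[𝕂] C)
    {Γ : Finset (Finset (Fin n))} (h : ∀ w, InFace Γ w → g (faceSum (generic 𝕂 a) w) = 0) :
    marginsIdeal 𝕂 a Γ ≤ RingHom.ker g := by
  refine iSup₂_le fun J hJ => Ideal.span_le.2 ?_
  rintro _ ⟨b, rfl⟩
  exact algHom_margin_eq_zero (fun w hw => h w ⟨J, hJ, hw⟩) b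

end Generic

theorem mem_facets {n : ℕ} {Δ : Finset (Finset (Fin n))} {J : Finset (Fin n)} :
    J ∈ facets Δ ↔ J ∈ Δ ∧ Maximal (fun F => F ∈ Δ) J := by
  simp [facets]

theorem exists_facet {n : ℕ} {Δ : Finset (Finset (Fin n))} {J : Finset (Fin n)} (hJ : J ∈ Δ) :
    ∃ J' ∈ facets Δ, J ⊆ J' := by
  obtain ⟨J', hJJ', hJ'⟩ := Δ.exists_le_maximal hJ
  exact ⟨J', mem_facets.2 ⟨hJ'.prop, hJ'⟩, hJJ'⟩

/-! ### Component ideals as kernels of monomial maps -/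

section Component

variable {𝕂 : Type*} [Field 𝕂] {n : ℕ} {a : Fin n → ℕ}
  {Δ : Finset (Finset (Fin n))} {π : Finpartition (facets Δ)}
  {κ : Finset (Finset (Fin n)) → Finset (Fin n)}

theorem mainIdeal_le_componentIdeal {Γ : Finset (Finset (Fin n))} (hΓ : Γ ∈ π.parts) :
    mainIdeal 𝕂 a Γ ≤ componentIdeal 𝕂 a π κ :=
  le_sup_of_le_left (le_iSup₂_of_le (f := fun Γ _ => mainIdeal 𝕂 a Γ) Γ hΓ le_rfl)

/-- Where `p` vanishes the exponent must be `0`, so the values of `f` and `g` there do not matter.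
-/
theorem prod_pow_congr_of_ne_zero {C D : Type*} [CommRing C] [IsDomain C] [CommMonoid D]
    {p : Cell a → C} {α : Cell a → ℕ} (h : ∏ w, p w ^ α w ≠ 0) {f g : Cell a → D}
    (hfg : ∀ w, p w ≠ 0 → f w = g w) : ∏ w, f w ^ α w = ∏ w, g w ^ α w := by
  refine Finset.prod_congr rfl fun w _ => ?_
  by_cases hw : p w = 0
  · have := Finset.prod_ne_zero_iff.1 h w (Finset.mem_univ w)
    rw [hw] at this
    have h0 : α w = 0 := by
      by_contra h0
      exact this (zero_pow h0)
    rw [h0, pow_zero, pow_zero]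
  · rw [hfg w hw]

theorem aeval_monomial_one {σ C : Type*} [Fintype σ] [CommRing C] [Algebra 𝕂 C] (f : σ → C)
    (α : σ →₀ ℕ) : MvPolynomial.aeval f (MvPolynomial.monomial α (1 : 𝕂)) = ∏ w, f w ^ α w := by
  rw [MvPolynomial.aeval_monomial, map_one, one_mul, Finsupp.prod_fintype]
  simp

variable [∀ j, NeZero (a j)]

/-- A cell below `Γ` whose face sum does not vanish on the component. -/
def Good (κ : Finset (Finset (Fin n)) → Finset (Fin n)) (Γ : Finset (Finset (Fin n)))
    (w : Cell a) : Prop := InFace Γ w ∧ κ Γ ⊆ supp w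

/-- A facet containing `supp w` contains `κ Γ`, and by admissibility only members of `Γ` do. Hence a
good cell belongs to one part only. -/
theorem Good.eq_of_inFace (hκ : Admissible π κ) {Γ Γ' : Finset (Finset (Fin n))}
    (hΓ : Γ ∈ π.parts) (hΓ' : Γ' ∈ π.parts) {w : Cell a} (h : Good κ Γ w) (h' : InFace Γ' w) :
    Γ = Γ' := by
  obtain ⟨J, hJ, hw⟩ := h'
  by_contra hne
  have hJΓ : J ∉ Γ := fun hJΓ => hne (π.eq_of_mem_parts hΓ hΓ' hJΓ hJ)
  obtain ⟨k, hk⟩ := (hκ Γ hΓ).2 J (π.le hΓ' hJ) hJΓ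
  rw [Finset.mem_sdiff] at hk
  exact hk.2 (hw (h.2 hk.1))

theorem inFace_deleteVertex {Γ : Finset (Finset (Fin n))} {k : Fin n} {w : Cell a} :
    InFace (deleteVertex Γ k) w ↔ InFace Γ w ∧ w k = 0 := by
  constructor
  · rintro ⟨J, hJ, hw⟩
    obtain ⟨J', hJ', rfl⟩ := Finset.mem_image.1 hJ
    refine ⟨⟨J', hJ', hw.trans (Finset.erase_subset _ _)⟩, ?_⟩
    by_contra h
    exact Finset.notMem_erase k J' (hw (by simpa using h))
  · rintro ⟨⟨J, hJ, hw⟩, h⟩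
    exact ⟨J.erase k, Finset.mem_image_of_mem _ hJ, fun j hj =>
      Finset.mem_erase.2 ⟨by rintro rfl; simp [h] at hj, hw hj⟩⟩

/-- Some `k ∈ κ Γ` is missing from the support, so the face sum already belongs to `L_{Γ ∖ k}`. -/
theorem faceSum_mem_componentIdeal {Γ : Finset (Finset (Fin n))} (hΓ : Γ ∈ π.parts) {w : Cell a}
    (hw : InFace Γ w) (hg : ¬ Good κ Γ w) :
    faceSum (generic 𝕂 a) w ∈ componentIdeal 𝕂 a π κ := by
  have : ¬ κ Γ ⊆ supp w := fun h => hg ⟨hw, h⟩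
  obtain ⟨k, hk, hkw⟩ := Finset.not_subset.1 this
  rw [mem_supp, not_not] at hkw
  refine le_sup_of_le_right (le_iSup₂_of_le
    (f := fun Γ _ => ⨆ k ∈ κ Γ, marginsIdeal 𝕂 a (deleteVertex Γ k)) Γ hΓ
    (le_iSup₂_of_le (f := fun k _ => marginsIdeal 𝕂 a (deleteVertex Γ k)) k hk le_rfl))
    (faceSum_mem_marginsIdeal (inFace_deleteVertex.2 ⟨hw, hkw⟩))

variable (𝕂 a) in
/-- The coordinate ring of the parameter space of a component: one set of Segre parameters for
each collection of faces, and a free variable for each cell. -/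
abbrev ParamRing :=
  MvPolynomial ((Finset (Finset (Fin n)) × Σ j : Fin n, Fin (a j)) ⊕ Cell a) 𝕂

open Classical in
variable (𝕂) in
/-- The value of a face sum in the parametrization of a component. -/
noncomputable def paramValue (π : Finpartition (facets Δ))
    (κ : Finset (Finset (Fin n)) → Finset (Fin n)) (w : Cell a) : ParamRing 𝕂 a :=
  if h : ∃ Γ ∈ π.parts, Good κ Γ w then
    ∏ j, MvPolynomial.X (Sum.inl (h.choose, Sigma.mk j (w j)))
  else if ∃ Γ ∈ π.parts, InFace Γ w then 0 else MvPolynomial.X (Sum.inr w)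

theorem paramValue_good (hκ : Admissible π κ) {Γ : Finset (Finset (Fin n))} (hΓ : Γ ∈ π.parts)
    {w : Cell a} (h : Good κ Γ w) :
    paramValue 𝕂 π κ w = ∏ j, MvPolynomial.X (Sum.inl (Γ, Sigma.mk j (w j))) := by
  have hex : ∃ Γ ∈ π.parts, Good κ Γ w := ⟨Γ, hΓ, h⟩
  rw [paramValue, dif_pos hex,
    h.eq_of_inFace hκ hΓ hex.choose_spec.1 hex.choose_spec.2.1]

theorem paramValue_bad (hκ : Admissible π κ) {Γ : Finset (Finset (Fin n))} (hΓ : Γ ∈ π.parts)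
    {w : Cell a} (hw : InFace Γ w) (h : ¬ Good κ Γ w) : paramValue 𝕂 π κ w = 0 := by
  rw [paramValue, dif_neg, if_pos ⟨Γ, hΓ, hw⟩]
  rintro ⟨Γ', hΓ', h'⟩
  rw [h'.eq_of_inFace hκ hΓ' hΓ hw] at h'
  exact h h'

theorem paramValue_free {w : Cell a} (h : ¬ ∃ Γ ∈ π.parts, InFace Γ w) :
    paramValue 𝕂 π κ w = MvPolynomial.X (Sum.inr w) := by
  rw [paramValue, dif_neg fun ⟨Γ, hΓ, hg⟩ => h ⟨Γ, hΓ, hg.1⟩, if_neg h]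

theorem paramValue_eq_zero_or_monomial (w : Cell a) : paramValue 𝕂 π κ w = 0 ∨
    ∃ m, paramValue 𝕂 π κ w = MvPolynomial.monomial m 1 := by
  unfold paramValue
  split_ifs with h h'
  · exact Or.inr ⟨_, (MvPolynomial.monomial_sum_one _ _).symm⟩
  · exact Or.inl rfl
  · exact Or.inr ⟨_, rfl⟩

variable (𝕂 a) in
/-- The parametrization of a component. -/
noncomputable def paramMap (π : Finpartition (facets Δ))
    (κ : Finset (Finset (Fin n)) → Finset (Fin n)) : TableRing 𝕂 a →ₐ[𝕂] ParamRing 𝕂 a :=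
  (MvPolynomial.aeval (paramValue 𝕂 π κ)).comp
    (faceEquiv 𝕂 a).symm.toAlgHom

theorem paramMap_faceSum (w : Cell a) :
    paramMap 𝕂 a π κ (faceSum (generic 𝕂 a) w) = paramValue 𝕂 π κ w := by
  have : (faceEquiv 𝕂 a).symm.toAlgHom (faceSum (generic 𝕂 a) w) = MvPolynomial.X w :=
    faceEquiv_symm_faceSum w
  rw [paramMap, AlgHom.comp_apply, this, MvPolynomial.aeval_X]

-- Setting to `0` the parameters of index `0` at the coordinates in `κ Γ` makes the bad cells
-- vanish, so good and bad cells below `Γ` obey one product formula.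
open Classical in
theorem paramMap_faceSum_eq_prod (hκ : Admissible π κ) {Γ : Finset (Finset (Fin n))}
    (hΓ : Γ ∈ π.parts) (w : Cell a) (hw : InFace Γ w) :
    paramMap 𝕂 a π κ (faceSum (generic 𝕂 a) w) =
      ∏ j, if j ∈ κ Γ ∧ w j = 0 then 0 else MvPolynomial.X (Sum.inl (Γ, Sigma.mk j (w j))) := by
  rw [paramMap_faceSum]
  by_cases h : Good κ Γ w
  · rw [paramValue_good hκ hΓ h]
    refine Finset.prod_congr rfl fun j _ => (if_neg ?_).symm
    rintro ⟨hj, h0⟩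
    exact mem_supp.1 (h.2 hj) h0
  · rw [paramValue_bad hκ hΓ hw h]
    obtain ⟨k, hk, hkw⟩ := Finset.not_subset.1 fun hs => h ⟨hw, hs⟩
    rw [mem_supp, not_not] at hkw
    symm
    exact Finset.prod_eq_zero (Finset.mem_univ k) (by rw [if_pos ⟨hk, hkw⟩])

theorem componentIdeal_le_ker (hκ : Admissible π κ) :
    componentIdeal 𝕂 a π κ ≤ RingHom.ker (paramMap 𝕂 a π κ) := by
  classical
  refine sup_le (iSup₂_le fun Γ hΓ => ?_) (iSup₂_le fun Γ hΓ => iSup₂_le fun k hk => ?_)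
  · exact mainIdeal_le_ker _ (fun j c => if j ∈ κ Γ ∧ c = 0 then 0 else
      MvPolynomial.X (Sum.inl (Γ, Sigma.mk j c))) (paramMap_faceSum_eq_prod hκ hΓ)
  · refine marginsIdeal_le_ker _ fun w hw => ?_
    rw [inFace_deleteVertex] at hw
    rw [paramMap_faceSum, paramValue_bad hκ hΓ hw.1]
    exact fun h => mem_supp.1 (h.2 hk) hw.2

theorem independenceIdeal_le_ker (hκ : Admissible π κ) :
    independenceIdeal 𝕂 a Δ ≤ RingHom.ker (paramMap 𝕂 a π κ) := by
  classical
  refine iSup₂_le fun J hJ => ?_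
  obtain ⟨J', hJ', hJJ'⟩ := exists_facet hJ
  obtain ⟨Γ, hΓ, hJΓ⟩ := π.exists_mem hJ'
  exact segreIdeal_margin_le_ker _ (fun j c => if j ∈ κ Γ ∧ c = 0 then 0 else
    MvPolynomial.X (Sum.inl (Γ, Sigma.mk j c)))
    fun w hw => paramMap_faceSum_eq_prod hκ hΓ w ⟨J', hJΓ, hw.trans hJJ'⟩

open Classical in
/-- The face sum at a cell that is good for `Γ`, and `1` at other cells. -/
noncomputable def goodFactor (𝕂 : Type*) [Field 𝕂]
    (κ : Finset (Finset (Fin n)) → Finset (Fin n)) (Γ : Finset (Finset (Fin n))) (w : Cell a) :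
    TableRing 𝕂 a := if Good κ Γ w then faceSum (generic 𝕂 a) w else 1

open Classical in
/-- The face sum at a cell that lies on no facet, and `1` at other cells. -/
noncomputable def freeFactor (𝕂 : Type*) [Field 𝕂] (π : Finpartition (facets Δ)) (w : Cell a) :
    TableRing 𝕂 a := if ∃ Γ ∈ π.parts, InFace Γ w then 1 else faceSum (generic 𝕂 a) w

theorem faceSum_eq_freeFactor_mul (hκ : Admissible π κ) {w : Cell a}
    (h : paramValue 𝕂 π κ w ≠ 0) :
    faceSum (generic 𝕂 a) w = freeFactor 𝕂 π w * ∏ Γ ∈ π.parts, goodFactor 𝕂 κ Γ w := by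
  by_cases hf : ∃ Γ ∈ π.parts, InFace Γ w
  · obtain ⟨Γ, hΓ, hw⟩ := hf
    have hg : Good κ Γ w := by
      by_contra hg
      exact h (paramValue_bad hκ hΓ hw hg)
    rw [freeFactor, if_pos ⟨Γ, hΓ, hw⟩, one_mul, Finset.prod_eq_single Γ, goodFactor, if_pos hg]
    · intro Γ' hΓ' hne
      rw [goodFactor, if_neg]
      exact fun h' => hne (h'.eq_of_inFace hκ hΓ' hΓ hw)
    · exact fun h => (h hΓ).elim
  · rw [freeFactor, if_neg hf, Finset.prod_eq_one, mul_one]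
    intro Γ hΓ
    rw [goodFactor, if_neg fun hg => hf ⟨Γ, hΓ, hg.1⟩]

/-- Setting all parameters foreign to `Γ` to `1` isolates the contribution of `Γ` to a monomial. -/
theorem exists_algHom_paramValue_goodFactor (hκ : Admissible π κ) {Γ : Finset (Finset (Fin n))}
    (hΓ : Γ ∈ π.parts) :
    ∃ θ : ParamRing 𝕂 a →ₐ[𝕂] MvPolynomial (Σ j : Fin n, Fin (a j)) 𝕂,
      ∀ w, paramValue 𝕂 π κ w ≠ 0 →
        θ (paramValue 𝕂 π κ w) = segreMap 𝕂 a (goodFactor 𝕂 κ Γ w) := by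
  classical
  refine ⟨MvPolynomial.aeval (Sum.elim (fun s => if s.1 = Γ then
    ∑ c ∈ slot s.2.2, MvPolynomial.X (Sigma.mk s.2.1 c) else 1) fun _ => 1), fun w h => ?_⟩
  by_cases hf : ∃ Γ ∈ π.parts, InFace Γ w
  · obtain ⟨Γ', hΓ', hw⟩ := hf
    have hg : Good κ Γ' w := by
      by_contra hg
      exact h (paramValue_bad hκ hΓ' hw hg)
    rw [paramValue_good hκ hΓ' hg, map_prod]
    by_cases hne : Γ' = Γ
    · subst hne
      rw [goodFactor, if_pos hg, segreMap_faceSum]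
      simp
    · rw [goodFactor, if_neg]
      · simp [hne]
      · exact fun h' => hne (h'.eq_of_inFace hκ hΓ hΓ' hw).symm
  · rw [paramValue_free hf, goodFactor, if_neg fun hg => hf ⟨Γ, hΓ, hg.1⟩]
    simp

theorem exists_algHom_paramValue_freeFactor (hκ : Admissible π κ) :
    ∃ θ : ParamRing 𝕂 a →ₐ[𝕂] TableRing 𝕂 a,
      ∀ w, paramValue 𝕂 π κ w ≠ 0 → θ (paramValue 𝕂 π κ w) = freeFactor 𝕂 π w := by
  refine ⟨MvPolynomial.aeval (Sum.elim (fun _ => 1) fun w => faceSum (generic 𝕂 a) w),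
    fun w h => ?_⟩
  by_cases hf : ∃ Γ ∈ π.parts, InFace Γ w
  · rw [freeFactor, if_pos hf]
    obtain ⟨Γ', hΓ', hw⟩ := hf
    have hg : Good κ Γ' w := by
      by_contra hg
      exact h (paramValue_bad hκ hΓ' hw hg)
    rw [paramValue_good hκ hΓ' hg, map_prod]
    simp
  · rw [paramValue_free hf, freeFactor, if_neg hf]
    simp

/-- Both monomials split into a free factor and one factor per part. Specializing the equality of
parameter values shows that the free factors agree and that the factors of each `Γ` have equal Segre
images, hence are congruent modulo `P_Γ`. -/
theorem prod_faceSum_sub_mem (hκ : Admissible π κ) {α β : Cell a → ℕ}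
    (h0 : ∏ w, paramValue 𝕂 π κ w ^ α w ≠ 0)
    (h : ∏ w, paramValue 𝕂 π κ w ^ α w = ∏ w, paramValue 𝕂 π κ w ^ β w) :
    ∏ w, faceSum (generic 𝕂 a) w ^ α w - ∏ w, faceSum (generic 𝕂 a) w ^ β w ∈
      componentIdeal 𝕂 a π κ := by
  have h0' : ∏ w, paramValue 𝕂 π κ w ^ β w ≠ 0 := h ▸ h0
  have expand : ∀ α : Cell a → ℕ, ∏ w, paramValue 𝕂 π κ w ^ α w ≠ 0 →
      ∏ w, faceSum (generic 𝕂 a) w ^ α w = (∏ w, freeFactor 𝕂 π w ^ α w) *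
        ∏ Γ ∈ π.parts, ∏ w, goodFactor 𝕂 κ Γ w ^ α w := by
    intro α hα
    rw [prod_pow_congr_of_ne_zero hα fun w hw => faceSum_eq_freeFactor_mul hκ hw,
      Finset.prod_comm, ← Finset.prod_mul_distrib]
    simp only [mul_pow, Finset.prod_pow]
  rw [expand α h0, expand β h0']
  have hfree : ∏ w, freeFactor 𝕂 π w ^ α w = ∏ w, freeFactor (a := a) 𝕂 π w ^ β w := by
    obtain ⟨θ, hθ⟩ := exists_algHom_paramValue_freeFactor (𝕂 := 𝕂) (a := a) hκ
    rw [← prod_pow_congr_of_ne_zero h0 hθ, ← prod_pow_congr_of_ne_zero h0' hθ]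
    simp only [← map_pow, ← map_prod, h]
  rw [hfree, ← mul_sub]
  refine Ideal.mul_mem_left _ _ (Ideal.Quotient.eq.1 ?_)
  rw [map_prod, map_prod]
  refine Finset.prod_congr rfl fun Γ hΓ => Ideal.Quotient.eq.2
    (mainIdeal_le_componentIdeal hΓ (prod_sub_prod_mem_mainIdeal (fun w => ?_) ?_))
  · unfold goodFactor
    split_ifs with hg
    · exact exists_tau_eq_faceSum hg.1
    · exact ⟨1, map_one _⟩
  · obtain ⟨θ, hθ⟩ := exists_algHom_paramValue_goodFactor (𝕂 := 𝕂) (a := a) hκ hΓ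
    rw [← prod_pow_congr_of_ne_zero h0 hθ, ← prod_pow_congr_of_ne_zero h0' hθ]
    simp only [← map_pow, ← map_prod, h]

theorem ker_aeval_paramValue_le (hκ : Admissible π κ) :
    RingHom.ker (MvPolynomial.aeval (R := 𝕂) (paramValue (a := a) 𝕂 π κ)) ≤
      (componentIdeal 𝕂 a π κ).comap (faceMap 𝕂 a) := by
  refine ker_le_of_monomial _ _ (fun α => ?_) (fun α h => ?_) fun α β h0 h => ?_
  · rw [aeval_monomial_one]
    by_cases h : ∏ w, paramValue 𝕂 π κ w ^ α w = 0
    · exact Or.inl h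
    · right
      have : ∀ w, ∃ m, paramValue 𝕂 π κ w ^ α w = MvPolynomial.monomial m 1 := by
        intro w
        rcases paramValue_eq_zero_or_monomial (𝕂 := 𝕂) (π := π) (κ := κ) w with h0 | ⟨m, hm⟩
        · have hne := Finset.prod_ne_zero_iff.1 h w (Finset.mem_univ w)
          have : α w = 0 := by
            by_contra h1
            exact hne (by rw [h0, zero_pow h1])
          exact ⟨0, by rw [this, pow_zero]; rfl⟩
        · exact ⟨α w • m, by rw [hm, MvPolynomial.monomial_pow, one_pow]⟩
      choose m hm using this
      exact ⟨∑ w, m w, by simp only [hm, MvPolynomial.monomial_sum_one]⟩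
  · rw [aeval_monomial_one] at h
    obtain ⟨w, -, hw⟩ := Finset.prod_eq_zero_iff.1 h
    have hα : α w ≠ 0 := by
      rintro h0
      rw [h0, pow_zero] at hw
      exact one_ne_zero hw
    have hw0 := eq_zero_of_pow_eq_zero hw
    have hmem : faceSum (generic 𝕂 a) w ∈ componentIdeal 𝕂 a π κ := by
      by_cases hf : ∃ Γ ∈ π.parts, InFace Γ w
      · obtain ⟨Γ, hΓ, hf⟩ := hf
        refine faceSum_mem_componentIdeal hΓ hf fun hg => ?_
        rw [paramValue_good hκ hΓ hg] at hw0
        exact Finset.prod_ne_zero_iff.2 (fun j _ => MvPolynomial.X_ne_zero _) hw0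
      · rw [paramValue_free hf] at hw0
        exact (MvPolynomial.X_ne_zero _ hw0).elim
    -- A monomial that vanishes contains a bad cell, whose face sum divides its image under
    -- `faceMap`.
    rw [Ideal.mem_comap, faceMap, aeval_monomial_one]
    exact Ideal.mem_of_dvd _ (Finset.dvd_prod_of_mem
      (fun w => faceSum (generic 𝕂 a) w ^ α w) (Finset.mem_univ w))
      (Ideal.pow_mem_of_mem _ hmem _ hα.bot_lt)
  · simp only [aeval_monomial_one] at h0 h
    rw [Ideal.mem_comap, map_sub, faceMap, aeval_monomial_one, aeval_monomial_one]
    exact prod_faceSum_sub_mem hκ h0 h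

theorem componentIdeal_eq_ker (hκ : Admissible π κ) :
    componentIdeal 𝕂 a π κ = RingHom.ker (paramMap 𝕂 a π κ) := by
  refine le_antisymm (componentIdeal_le_ker hκ) fun x hx => ?_
  have := ker_aeval_paramValue_le (𝕂 := 𝕂) (a := a) hκ
    (show (faceEquiv 𝕂 a).symm x ∈ _ from hx)
  rw [Ideal.mem_comap] at this
  rwa [show faceMap 𝕂 a ((faceEquiv 𝕂 a).symm x) = x from
    (faceEquiv 𝕂 a).apply_symm_apply x] at this

theorem componentIdeal_isPrime (hκ : Admissible π κ) : (componentIdeal 𝕂 a π κ).IsPrime := by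
  rw [componentIdeal_eq_ker hκ]
  exact RingHom.ker_isPrime _

theorem independenceIdeal_le_componentIdeal (hκ : Admissible π κ) :
    independenceIdeal 𝕂 a Δ ≤ componentIdeal 𝕂 a π κ := by
  rw [componentIdeal_eq_ker hκ]
  exact independenceIdeal_le_ker hκ

end Component

/-! ### Rank-one tables and their common support -/

section RankOne

variable {n : ℕ} {a : Fin n → ℕ} {F : Type*} [Field F]

variable [∀ j, NeZero (a j)]

/-- The `2 × 2` minors of the cells supported in `J` vanish. -/
def RankOneOn (T : Cell a → F) (J : Finset (Fin n)) : Prop :=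
  ∀ w v, supp w ⊆ J → supp v ⊆ J → ∀ l,
    T w * T v = T (Function.update w l (v l)) * T (Function.update v l (w l))

open Classical in
/-- The coordinates in `J` that are nonzero at each cell supported in `J` with a nonzero entry. -/
noncomputable def commonSupport (T : Cell a → F) (J : Finset (Fin n)) : Finset (Fin n) :=
  J.filter fun j => ∀ w, supp w ⊆ J → T w ≠ 0 → w j ≠ 0

variable {T : Cell a → F} {J J' : Finset (Fin n)}

theorem mem_commonSupport {j : Fin n} :
    j ∈ commonSupport T J ↔ j ∈ J ∧ ∀ w, supp w ⊆ J → T w ≠ 0 → w j ≠ 0 := by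
  simp [commonSupport]

theorem commonSupport_subset : commonSupport T J ⊆ J := fun _ hj => (mem_commonSupport.1 hj).1

theorem commonSupport_subset_supp {w : Cell a} (hw : supp w ⊆ J) (h : T w ≠ 0) :
    commonSupport T J ⊆ supp w := fun _ hj =>
  mem_supp.2 ((mem_commonSupport.1 hj).2 w hw h)

/-- The condition is vacuous for a zero table. This convention keeps a facet with zero table apart
from every other facet in the admissibility argument. -/
theorem commonSupport_of_forall_eq_zero (h : ∀ w, supp w ⊆ J → T w = 0) :
    commonSupport T J = J :=
  commonSupport_subset.antisymm fun _ hj =>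
    mem_commonSupport.2 ⟨hj, fun w hw h0 => (h0 (h w hw)).elim⟩

/-- Take a nonzero cell of minimal support. If `j` in it were not common, an exchange at `j` with a
nonzero cell `v`, `v j = 0`, would give a nonzero cell of smaller support. -/
theorem RankOneOn.exists_supp_eq (hT : RankOneOn T J) {w : Cell a} (hw : supp w ⊆ J)
    (h : T w ≠ 0) : ∃ w₀, supp w₀ = commonSupport T J ∧ T w₀ ≠ 0 := by
  classical
  obtain ⟨w₀, hw₀, hmin⟩ := Finset.exists_min_image
    (Finset.univ.filter fun w : Cell a => supp w ⊆ J ∧ T w ≠ 0) (fun w => (supp w).card)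
    ⟨w, by simpa using ⟨hw, h⟩⟩
  simp only [Finset.mem_filter, Finset.mem_univ, true_and] at hw₀ hmin
  refine ⟨w₀, Finset.Subset.antisymm (fun j hj => ?_)
    (commonSupport_subset_supp hw₀.1 hw₀.2), hw₀.2⟩
  by_contra hjS
  simp only [mem_commonSupport, hw₀.1 hj, true_and] at hjS
  push Not at hjS
  obtain ⟨v, hv, hv0, hvj⟩ := hjS
  have hprod := hT w₀ v hw₀.1 hv j
  have hne : T (Function.update w₀ j (v j)) ≠ 0 :=
    left_ne_zero_of_mul (hprod ▸ mul_ne_zero hw₀.2 hv0)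
  have hle := hmin _ ⟨supp_update_subset hw₀.1 hv j, hne⟩
  refine absurd hle (not_le.2 (Finset.card_lt_card ?_))
  refine (Finset.ssubset_iff_of_subset fun i hi => ?_).2 ⟨j, hj, by simp [hvj]⟩
  rcases eq_or_ne i j with rfl | hij
  · exact hj
  · simpa [Function.update_of_ne hij] using hi

/-- The nonzero cell realizing the common support of `J` also lies in `J'`, which gives one
inclusion; the cell realizing that of `J'` then lies in `J` and gives the other. -/
theorem RankOneOn.commonSupport_eq (hT : RankOneOn T J) (hT' : RankOneOn T J') {w : Cell a}
    (hw : supp w ⊆ J) (h : T w ≠ 0) (hJ : commonSupport T J ⊆ J') :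
    commonSupport T J = commonSupport T J' := by
  obtain ⟨w₀, hs, h0⟩ := hT.exists_supp_eq hw h
  have h1 : commonSupport T J' ⊆ commonSupport T J :=
    hs ▸ commonSupport_subset_supp (hs ▸ hJ) h0
  obtain ⟨v, hv, hv0⟩ := hT'.exists_supp_eq (hs ▸ hJ : supp w₀ ⊆ J') h0
  refine Finset.Subset.antisymm ?_ h1
  rw [← hv]
  exact commonSupport_subset_supp (hv ▸ h1.trans commonSupport_subset) hv0

theorem RankOneOn.eq_mul_prod (hT : RankOneOn T J) {w₀ : Cell a} (hw₀ : supp w₀ ⊆ J)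
    (h0 : T w₀ ≠ 0) {w : Cell a} (hw : supp w ⊆ J) :
    T w = T w₀ * ∏ j, (T (Function.update w₀ j (w j)) / T w₀) := by
  -- Induction on the coordinates where `w` may differ from `w₀`; each is reset by one exchange with
  -- `w₀`.
  suffices H : ∀ Q : Finset (Fin n), ∀ w : Cell a, supp w ⊆ J → (∀ j ∉ Q, w j = w₀ j) →
      T w = T w₀ * ∏ j ∈ Q, (T (Function.update w₀ j (w j)) / T w₀) from
    H Finset.univ w hw fun j hj => (hj (Finset.mem_univ j)).elim
  intro Q
  induction Q using Finset.induction_on with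
  | empty =>
    intro w _ h
    rw [show w = w₀ from funext fun j => h j (Finset.notMem_empty j)]
    simp
  | insert k Q hk ih =>
    intro w hw h
    have h1 := hT w w₀ hw hw₀ k
    have h2 := ih (Function.update w k (w₀ k)) (supp_update_subset hw hw₀ k) fun j hj => by
      rcases eq_or_ne j k with rfl | hjk
      · simp
      · rw [Function.update_of_ne hjk]
        exact h j (by simp [hjk, hj])
    have h3 : ∏ j ∈ Q, (T (Function.update w₀ j (Function.update w k (w₀ k) j)) / T w₀) =
        ∏ j ∈ Q, (T (Function.update w₀ j (w j)) / T w₀) :=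
      Finset.prod_congr rfl fun j hj => by
        rw [Function.update_of_ne (ne_of_mem_of_not_mem hj hk)]
    rw [Finset.prod_insert hk]
    rw [h3] at h2
    rw [h2] at h1
    rw [eq_div_of_mul_eq h0 h1]
    ring

theorem exists_forall_eq_prod (hn : 0 < n) {Γ : Finset (Finset (Fin n))}
    (hT : ∀ J ∈ Γ, RankOneOn T J)
    (hS : ∀ J ∈ Γ, ∀ J' ∈ Γ, commonSupport T J = commonSupport T J') :
    ∃ η : ∀ j, Fin (a j) → F, ∀ w, InFace Γ w → T w = ∏ j, η j (w j) := by
  by_cases hz : ∃ w, InFace Γ w ∧ T w ≠ 0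
  · obtain ⟨w, ⟨J, hJ, hw⟩, h⟩ := hz
    obtain ⟨w₀, hs, h0⟩ := (hT J hJ).exists_supp_eq hw h
    -- The support of `w₀` lies in every member of `Γ`, so `w₀` is a common base point. The scalar
    -- `T w₀` is absorbed into the first coordinate.
    refine ⟨fun j c => (if j = ⟨0, hn⟩ then T w₀ else 1) *
      (T (Function.update w₀ j c) / T w₀), ?_⟩
    rintro v ⟨J', hJ', hv⟩
    rw [Finset.prod_mul_distrib, Finset.prod_ite_eq' Finset.univ, if_pos (Finset.mem_univ _)]
    refine (hT J' hJ').eq_mul_prod ?_ h0 hv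
    rw [hs, hS J hJ J' hJ']
    exact commonSupport_subset
  · push Not at hz
    exact ⟨0, fun w hw => by
      rw [hz w hw]
      exact (Finset.prod_eq_zero (Finset.mem_univ (⟨0, hn⟩ : Fin n)) rfl).symm⟩

end RankOne

/-- The partition of a finite set into the nonempty fibres of a map. -/
def fibrePartition {α β : Type*} [DecidableEq α] [DecidableEq β] (s : Finset α) (f : α → β) :
    Finpartition s :=
  Finpartition.ofExistsUnique (s.image fun x => s.filter fun y => f y = f x)
    (by
      intro p hp
      obtain ⟨x, -, rfl⟩ := Finset.mem_image.1 hp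
      exact Finset.filter_subset _ _)
    (by
      intro x hx
      refine ⟨s.filter fun y => f y = f x,
        ⟨Finset.mem_image.2 ⟨x, hx, rfl⟩, Finset.mem_filter.2 ⟨hx, rfl⟩⟩, ?_⟩
      rintro p ⟨hp, hxp⟩
      obtain ⟨y, -, rfl⟩ := Finset.mem_image.1 hp
      rw [(Finset.mem_filter.1 hxp).2])
    (by
      intro h
      obtain ⟨x, hx, h⟩ := Finset.mem_image.1 h
      exact Finset.notMem_empty x (h ▸ Finset.mem_filter.2 ⟨hx, rfl⟩))

theorem mem_iff_of_mem_fibrePartition {α β : Type*} [DecidableEq α] [DecidableEq β]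
    {s : Finset α} {f : α → β} {p : Finset α} (hp : p ∈ (fibrePartition s f).parts) {x : α}
    (hx : x ∈ p) (y : α) : y ∈ p ↔ y ∈ s ∧ f y = f x := by
  obtain ⟨z, -, rfl⟩ := Finset.mem_image.1 hp
  rw [Finset.mem_filter, (Finset.mem_filter.1 hx).2]

theorem eq_of_subset_of_mem_facets {n : ℕ} {Δ : Finset (Finset (Fin n))} {J J' : Finset (Fin n)}
    (hJ : J ∈ facets Δ) (hJ' : J' ∈ facets Δ) (h : J ⊆ J') : J = J' := by
  rw [mem_facets] at hJ hJ'
  exact hJ.2.eq_of_le hJ'.1 h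

/-! ### A component ideal inside each prime over `I_Δ` -/

section Components

variable {𝕂 : Type*} [Field 𝕂] {n : ℕ} {a : Fin n → ℕ} [∀ j, NeZero (a j)]
  {Δ : Finset (Finset (Fin n))}

theorem admissible_fibrePartition {F : Type*} [Field F] {T : Cell a → F}
    (hT : ∀ J ∈ facets Δ, RankOneOn T J) :
    Admissible (fibrePartition (facets Δ) (commonSupport T))
      -- All facets in a part have the same common support, so this union is just that set.
      (fun Γ => Γ.sup (commonSupport T)) := by
  intro Γ hΓ
  refine ⟨fun J hJ => Finset.sup_le fun J' hJ' => ?_, fun J hJ hJΓ => ?_⟩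
  · rw [((mem_iff_of_mem_fibrePartition hΓ hJ J').1 hJ').2]
    exact commonSupport_subset
  · obtain ⟨J', hJ'⟩ := Finpartition.nonempty_of_mem_parts _ hΓ
    have hJ'Δ := ((mem_iff_of_mem_fibrePartition hΓ hJ' J').1 hJ').1
    rw [Finset.sdiff_nonempty]
    intro hsub
    have hsub : commonSupport T J' ⊆ J :=
      (Finset.le_sup (f := commonSupport T) hJ').trans hsub
    refine hJΓ ((mem_iff_of_mem_fibrePartition hΓ hJ' J).2 ⟨hJ, ?_⟩)
    by_cases h : ∃ w, supp w ⊆ J' ∧ T w ≠ 0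
    · obtain ⟨w, hw, h⟩ := h
      exact ((hT J' hJ'Δ).commonSupport_eq (hT J hJ) hw h hsub).symm
    · push Not at h
      rw [commonSupport_of_forall_eq_zero h] at hsub
      rw [eq_of_subset_of_mem_facets hJ'Δ hJ hsub]

theorem componentIdeal_fibrePartition_le_ker (hn : 0 < n) {F : Type*} [Field F] [Algebra 𝕂 F]
    (g : TableRing 𝕂 a →ₐ[𝕂] F)
    (hT : ∀ J ∈ facets Δ, RankOneOn (fun w => g (faceSum (generic 𝕂 a) w)) J) :
    componentIdeal 𝕂 a
      (fibrePartition (facets Δ) (commonSupport fun w => g (faceSum (generic 𝕂 a) w)))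
      (fun Γ => Γ.sup (commonSupport fun w => g (faceSum (generic 𝕂 a) w))) ≤
        RingHom.ker g := by
  refine sup_le (iSup₂_le fun Γ hΓ => ?_) (iSup₂_le fun Γ hΓ => iSup₂_le fun k hk => ?_)
  · obtain ⟨η, hη⟩ := exists_forall_eq_prod hn
      (fun J hJ => hT J ((mem_iff_of_mem_fibrePartition hΓ hJ J).1 hJ).1)
      (fun J hJ J' hJ' => ((mem_iff_of_mem_fibrePartition hΓ hJ' J).1 hJ).2)
    exact mainIdeal_le_ker g η hη
  · refine marginsIdeal_le_ker g fun w hw => ?_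
    obtain ⟨⟨J, hJ, hw⟩, hk0⟩ := inFace_deleteVertex.1 hw
    obtain ⟨J', hJ', hkJ'⟩ := Finset.mem_sup.1 hk
    rw [((mem_iff_of_mem_fibrePartition hΓ hJ J').1 hJ').2] at hkJ'
    by_contra h
    -- A nonzero face sum would contain the common support, hence `k`, in its support.
    exact mem_supp.1 (commonSupport_subset_supp hw h hkJ') hk0

theorem rankOneOn_of_independenceIdeal_le_ker {F : Type*} [Field F] [Algebra 𝕂 F]
    (g : TableRing 𝕂 a →ₐ[𝕂] F) (hg : independenceIdeal 𝕂 a Δ ≤ RingHom.ker g)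
    {J : Finset (Fin n)} (hJ : J ∈ Δ) :
    RankOneOn (fun w => g (faceSum (generic 𝕂 a) w)) J := by
  intro w v hw hv l
  have hfs : ∀ w, g (faceSum (generic 𝕂 a) w) = faceSum (fun i => g (generic 𝕂 a i)) w :=
    map_faceSum (g : TableRing 𝕂 a →+* F) (generic 𝕂 a)
  simp only [hfs]
  refine faceSum_mul_faceSum (fun l i j => ?_) hw hv l
  have h1 : minor (margin (generic 𝕂 a) J) l i j ∈ independenceIdeal 𝕂 a Δ :=
    le_iSup₂_of_le (f := fun J _ => segreIdeal (margin (generic 𝕂 a) J)) J hJ le_rfl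
      (Ideal.subset_span ⟨l, i, j, rfl⟩)
  have h2 := map_minor (g : TableRing 𝕂 a →+* F) (margin (generic 𝕂 a) J) l i j
  have h3 : (fun b => (g : TableRing 𝕂 a →+* F) (margin (generic 𝕂 a) J b)) =
      margin (fun i => g (generic 𝕂 a i)) J :=
    funext fun b => map_margin (g : TableRing 𝕂 a →+* F) (generic 𝕂 a) J b
  rw [h3] at h2
  rw [← h2]
  exact hg h1

theorem exists_componentIdeal_le (hn : 0 < n) {p : Ideal (TableRing 𝕂 a)} (hp : p.IsPrime)
    (h : independenceIdeal 𝕂 a Δ ≤ p) :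
    ∃ (π : Finpartition (facets Δ)) (κ : Finset (Finset (Fin n)) → Finset (Fin n)),
      Admissible π κ ∧ componentIdeal 𝕂 a π κ ≤ p := by
  -- The rank-one factorization divides by a nonzero entry, so values are taken in a field.
  let g : TableRing 𝕂 a →ₐ[𝕂] FractionRing (TableRing 𝕂 a ⧸ p) :=
    (IsScalarTower.toAlgHom 𝕂 (TableRing 𝕂 a ⧸ p) _).comp (Ideal.Quotient.mkₐ 𝕂 p)
  have hker : RingHom.ker g = p := by
    ext x
    rw [RingHom.mem_ker, AlgHom.comp_apply, IsScalarTower.coe_toAlgHom',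
      map_eq_zero_iff _ (IsFractionRing.injective _ _)]
    exact Ideal.Quotient.eq_zero_iff_mem
  have hT : ∀ J ∈ facets Δ, RankOneOn (fun w => g (faceSum (generic 𝕂 a) w)) J := fun J hJ =>
    rankOneOn_of_independenceIdeal_le_ker g (hker.symm ▸ h) (mem_facets.1 hJ).1
  exact ⟨_, _, admissible_fibrePartition hT,
    (componentIdeal_fibrePartition_le_ker hn g hT).trans hker.le⟩

end Components

end MarginalIndependence

theorem mainTheorem7 {𝕂 : Type*} [Field 𝕂] {n : ℕ} (hn : 0 < n) (a : Fin n → ℕ)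
    (ha : ∀ j, 0 < a j) (Δ : Finset (Finset (Fin n)))
    (hΔ : IsLowerSet (Δ : Set (Finset (Fin n)))) :
    (∀ (π : Finpartition (MarginalIndependence.facets Δ))
        (κ : Finset (Finset (Fin n)) → Finset (Fin n)),
        MarginalIndependence.Admissible π κ →
          (MarginalIndependence.componentIdeal 𝕂 a π κ).IsPrime) ∧
      ∀ 𝔭 ∈ (MarginalIndependence.independenceIdeal 𝕂 a Δ).minimalPrimes,
        ∃ (π : Finpartition (MarginalIndependence.facets Δ))
          (κ : Finset (Finset (Fin n)) → Finset (Fin n)),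
          MarginalIndependence.Admissible π κ ∧
            𝔭 = MarginalIndependence.componentIdeal 𝕂 a π κ := by
  have : ∀ j, NeZero (a j) := fun j => ⟨(ha j).ne'⟩
  refine ⟨fun π κ hκ => MarginalIndependence.componentIdeal_isPrime hκ, fun 𝔭 h𝔭 => ?_⟩
  obtain ⟨π, κ, hκ, hle⟩ :=
    MarginalIndependence.exists_componentIdeal_le hn h𝔭.1.1 h𝔭.1.2
  exact ⟨π, κ, hκ, le_antisymm (h𝔭.2 ⟨MarginalIndependence.componentIdeal_isPrime hκ,
    MarginalIndependence.independenceIdeal_le_componentIdeal hκ⟩ hle) hle⟩
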